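/- Let $L$ be a finite-dimensional (left) Leibniz algebra over an arbitrary field $\mathbb F$, i.e. a vector space with a bilinear multiplication satisfying $a(bc)=(ab)c+b(ac)$ for all $a,b,c\in L$; it is a Lie algebra if moreover $xx=0$ for all $x$. For subspaces $S,T$ let $ST$ be the span of all products $st$ with $s\in S$, $t\in T$, and put $S^2=SS$. Ideals are two-sided; a minimal ideal is one that is minimal among the nonzero ideals; an ideal $M$ is abelian if $M^2=0$. A Leibniz algebra is solvable if its derived series reaches $0$, nilpotent if its lower central series $S, SS, S(SS),\dots$ reaches $0$, and strongly solvable if its square is nilpotent. $L$ is minimally non-strongly solvable if $L$ is not strongly solvable but every proper subalgebra of $L$ is. $L$ is $\phi$-free if its Frattini ideal, the largest ideal of $L$ contained in the intersection of all maximal subalgebras of $L$, is $0$. $\mathrm{Leib}(L)$ denotes the span of all squares $xx$, $x\in L$. Suppose that $L$ is solvable, $\phi$-free and minimally non-strongly solvable. Then $\mathbb F$ has characteristic $p>0$, and $L=A+H$ is a semidirect sum of an ideal $A$ and a subalgebra $H$ (so $L=A\oplus H$ as a vector space) such that 1. $A$ is the unique minimal ideal of $L$; 2. $\dim A\ge 2$;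 3. $A^2=0$; 4. either $H=M\oplus\mathbb Fx$ as a vector space, where $M$ is a minimal ideal of $H$ that is abelian and $0\ne x\in H$, or $H$ is the three-dimensional Heisenberg algebra, i.e. $H$ has a basis $x,y,z$ with $xy=z=-yx$ and all other products of basis elements equal to $0$; 5. either $L$ is a Lie algebra, or $H$ is a Lie algebra, $A=\mathrm{Leib}(L)$ and $AL=0$. -/

import Mathlib

/-- A (left) Leibniz ring: left multiplications are derivations. Together with a compatible module
structure over a field this is a (left) Leibniz algebra. -/
class IsLeibniz (L : Type*) [NonUnitalNonAssocRing L] : Prop where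
  leibniz : ∀ a b c : L, a * (b * c) = (a * b) * c + b * (a * c)

namespace Leibniz

section Basic

variable {F L : Type*} [Field F] [NonUnitalNonAssocRing L] [Module F L]

/-- The product `S T` of two subspaces: the span of all products `s * t`. -/
def prod (S T : Submodule F L) : Submodule F L :=
  Submodule.span F {z | ∃ s ∈ S, ∃ t ∈ T, s * t = z}

/-- The derived series of a subalgebra `S`: `S, S S, (S S)(S S), …`. -/
def derivedSeries (S : Submodule F L) : ℕ → Submodule F L
  | 0 => S
  | n + 1 => prod (derivedSeries S n) (derivedSeries S n)

/-- The lower central series of a subalgebra `S`: `S, S S, S (S S), …`. -/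
def lowerCentralSeries (S : Submodule F L) : ℕ → Submodule F L
  | 0 => S
  | n + 1 => prod S (lowerCentralSeries S n)

/-- The subalgebra `S` is solvable. -/
def IsSolvable (S : Submodule F L) : Prop := ∃ n, derivedSeries S n = ⊥

/-- The subalgebra `S` is nilpotent. -/
def IsNilpotent (S : Submodule F L) : Prop := ∃ n, lowerCentralSeries S n = ⊥

/-- The subalgebra `S` is strongly solvable: its square is nilpotent. -/
def IsStronglySolvable (S : Submodule F L) : Prop := IsNilpotent (prod S S)

/-- The (Leibniz) subalgebra `S` is a Lie algebra: its multiplication is alternating. -/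
def IsLie (S : Submodule F L) : Prop := ∀ x ∈ S, x * x = 0

/-- `I` is a (two-sided) ideal of the subalgebra `S`. -/
def IsIdeal (S I : Submodule F L) : Prop :=
  I ≤ S ∧ ∀ s ∈ S, ∀ a ∈ I, s * a ∈ I ∧ a * s ∈ I

/-- `I` is a minimal ideal of the subalgebra `S`: minimal among the nonzero ideals. -/
def IsMinimalIdeal (S I : Submodule F L) : Prop :=
  IsIdeal S I ∧ I ≠ ⊥ ∧ ∀ J : Submodule F L, IsIdeal S J → J ≤ I → J ≠ ⊥ → J = I

/-- `H` is a three-dimensional Heisenberg algebra: it has a basis `x, y, z` with `xy = z = -yx`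
and all other products of basis elements equal to zero. -/
def IsHeisenberg (H : Submodule F L) : Prop :=
  ∃ x y z : L, LinearIndependent F ![x, y, z] ∧ Submodule.span F {x, y, z} = H ∧
    x * y = z ∧ y * x = -z ∧ x * x = 0 ∧ y * y = 0 ∧ z * z = 0 ∧
    x * z = 0 ∧ z * x = 0 ∧ y * z = 0 ∧ z * y = 0

/-- `H` is the vector space direct sum of a minimal ideal `M` of `H`, which is abelian, and a
line `F x`. -/
def IsMinimalAbelianPlusLine (H : Submodule F L) : Prop :=
  ∃ (M : Submodule F L) (x : L), IsMinimalIdeal H M ∧ prod M M = ⊥ ∧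
    x ≠ 0 ∧ Disjoint M (Submodule.span F {x}) ∧ M ⊔ Submodule.span F {x} = H

end Basic

section Algebra

variable (F L : Type*) [Field F] [NonUnitalNonAssocRing L] [Module F L]

/-- `Leib(L)`: the span of all squares. -/
def leib : Submodule F L := Submodule.span F {z | ∃ x : L, x * x = z}

/-- The Frattini subalgebra: the intersection of all maximal subalgebras. -/
def frattiniSubalgebra [IsScalarTower F L L] [SMulCommClass F L L] : NonUnitalSubalgebra F L :=
  sInf {K | IsCoatom K}

/-- The Frattini ideal: the largest ideal contained in the Frattini subalgebra (a sum of ideals is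
an ideal). -/
def frattiniIdeal [IsScalarTower F L L] [SMulCommClass F L L] : Submodule F L :=
  sSup {I | IsIdeal ⊤ I ∧ I ≤ (frattiniSubalgebra F L).toSubmodule}

/-- `L` is not strongly solvable, but each of its proper subalgebras is. -/
def IsMinimallyNonStronglySolvable [IsScalarTower F L L] [SMulCommClass F L L] : Prop :=
  ¬ IsStronglySolvable (⊤ : Submodule F L) ∧
    ∀ K : NonUnitalSubalgebra F L, K ≠ ⊤ → IsStronglySolvable K.toSubmodule

end Algebra

end Leibniz

set_option linter.unusedSectionVars false

namespace Leibniz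

/-! ### Products of subspaces and the associated series -/

section Products

variable {F L : Type*} [Field F] [NonUnitalNonAssocRing L] [Module F L]

/-! A minimal ideal `A` is abelian because `L` is solvable, and has a complementary subalgebra `H`
because `L` is `φ`-free. As `H` is strongly solvable, the lower central series of `L²` ends inside
`A`. Two distinct minimal ideals would force it into their zero intersection, so `A` is unique
(`isMinimalIdeal_unique`).

Uniqueness makes left multiplication of `H` on `A` faithful and irreducible
(`isFaithfulIrreducible_of_isCompl`). For a proper subalgebra `K` of `H`, `A + K` is proper in `L`,
so `K²` acts nilpotently on `A`. An ideal of `H` acting nilpotently is zero; hence every proper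
ideal of `H` is abelian, in particular `N = H²`, which is neither `0` nor `H`.

If `H = N + Fu` for some `u`, then `u` acts bijectively on `N`, and minimality of `L` makes `N` a
minimal ideal of `H`. Otherwise every `N + Fu` is a proper, hence abelian, ideal; so `N` is central
and `H` is Heisenberg.

In both cases each `m ∈ N` is a product `xy` with `my = 0`. In characteristic zero
`isNilpotent_commutator` makes `m` act nilpotently, so `N = 0`, a contradiction. Finally, on a line
the action of `N` would consist of commutators of scalars, so `dim A ≥ 2`. -/

theorem mul_mem_prod {S T : Submodule F L} {s t : L} (hs : s ∈ S) (ht : t ∈ T) :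
    s * t ∈ prod S T :=
  Submodule.subset_span ⟨s, hs, t, ht, rfl⟩

theorem prod_le {S T U : Submodule F L} : prod S T ≤ U ↔ ∀ s ∈ S, ∀ t ∈ T, s * t ∈ U := by
  refine ⟨fun h s hs t ht => h (mul_mem_prod hs ht), fun h => Submodule.span_le.2 ?_⟩
  rintro _ ⟨s, hs, t, ht, rfl⟩
  exact h s hs t ht

theorem prod_mono {S S' T T' : Submodule F L} (hS : S ≤ S') (hT : T ≤ T') :
    prod S T ≤ prod S' T' :=
  prod_le.2 fun _ hs _ ht => mul_mem_prod (hS hs) (hT ht)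

theorem prod_eq_bot {S T : Submodule F L} : prod S T = ⊥ ↔ ∀ s ∈ S, ∀ t ∈ T, s * t = 0 := by
  rw [← le_bot_iff, prod_le]
  simp

theorem derivedSeries_mono {S T : Submodule F L} (h : S ≤ T) (n : ℕ) :
    derivedSeries S n ≤ derivedSeries T n := by
  induction n with
  | zero => exact h
  | succ n ih => exact prod_mono ih ih

theorem IsSolvable.mono {S T : Submodule F L} (h : S ≤ T) (hT : IsSolvable T) : IsSolvable S := by
  obtain ⟨n, hn⟩ := hT
  exact ⟨n, le_bot_iff.1 (hn ▸ derivedSeries_mono h n)⟩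

theorem IsSolvable.eq_bot_of_prod_self_eq {S : Submodule F L} (hS : IsSolvable S)
    (h : prod S S = S) : S = ⊥ := by
  obtain ⟨n, hn⟩ := hS
  have key : ∀ n, derivedSeries S n = S := by
    intro n
    induction n with
    | zero => rfl
    | succ n ih => rw [derivedSeries, ih, h]
  rw [← hn, key]

theorem lowerCentralSeries_add_le {S I : Submodule F L} (hI : ∀ s ∈ S, ∀ a ∈ I, s * a ∈ I) {n : ℕ}
    (h : lowerCentralSeries S n ≤ I) (k : ℕ) : lowerCentralSeries S (n + k) ≤ I := by
  induction k with
  | zero => exact h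
  | succ k ih => exact prod_le.2 fun s hs t ht => hI s hs t (ih ht)

theorem IsIdeal.inf {S I J : Submodule F L} (hI : IsIdeal S I) (hJ : IsIdeal S J) :
    IsIdeal S (I ⊓ J) :=
  ⟨inf_le_left.trans hI.1, fun s hs a ha =>
    ⟨⟨(hI.2 s hs a ha.1).1, (hJ.2 s hs a ha.2).1⟩, ⟨(hI.2 s hs a ha.1).2, (hJ.2 s hs a ha.2).2⟩⟩⟩

theorem exists_isMinimalIdeal_le [FiniteDimensional F L] {S I : Submodule F L} (hI : IsIdeal S I)
    (h : I ≠ ⊥) : ∃ J ≤ I, IsMinimalIdeal S J := by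
  obtain ⟨J, ⟨h1, h2, h3⟩, hm⟩ := (wellFounded_lt (α := Submodule F L)).has_min
    {J | IsIdeal S J ∧ J ≤ I ∧ J ≠ ⊥} ⟨I, hI, le_rfl, h⟩
  exact ⟨J, h2, h1, h3, fun K hK hKJ hK0 => by
    by_contra hne
    exact hm K ⟨hK, hKJ.trans h2, hK0⟩ (lt_of_le_of_ne hKJ hne)⟩

/-- The iterated products `S (S (⋯ (S A)))` with `n` factors `S`. -/
def iteratedAction (S A : Submodule F L) : ℕ → Submodule F L
  | 0 => A
  | n + 1 => prod S (iteratedAction S A n)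

theorem iteratedAction_mono {S T : Submodule F L} (h : S ≤ T) (A : Submodule F L) (n : ℕ) :
    iteratedAction S A n ≤ iteratedAction T A n := by
  induction n with
  | zero => exact le_rfl
  | succ n ih => exact prod_mono h ih

end Products

/-! ### Ideals, complements and uniqueness of the minimal ideal -/

section Ideals

variable {F L : Type*} [Field F] [NonUnitalNonAssocRing L] [Module F L]
  [IsScalarTower F L L] [SMulCommClass F L L]

theorem mul_mem_of_mem_span {s : Set L} {U : Submodule F L} {x a : L}
    (h : ∀ b ∈ s, x * b ∈ U) (ha : a ∈ Submodule.span F s) : x * a ∈ U :=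
  (Submodule.span_le (p := U.comap (LinearMap.mulLeft F x))).2 h ha

theorem mem_mul_of_mem_span {s : Set L} {U : Submodule F L} {x a : L}
    (h : ∀ b ∈ s, b * x ∈ U) (ha : a ∈ Submodule.span F s) : a * x ∈ U :=
  (Submodule.span_le (p := U.comap (LinearMap.mulRight F x))).2 h ha

theorem IsIdeal.prod_self [IsLeibniz L] {S I : Submodule F L} (hI : IsIdeal S I) :
    IsIdeal S (prod I I) := by
  refine ⟨prod_le.2 fun s hs t ht => hI.1 (hI.2 s (hI.1 hs) t ht).1, fun s hs a ha => ⟨?_, ?_⟩⟩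
  · refine mul_mem_of_mem_span ?_ ha
    rintro _ ⟨b, hb, c, hc, rfl⟩
    rw [IsLeibniz.leibniz]
    exact add_mem (mul_mem_prod (hI.2 s hs b hb).1 hc) (mul_mem_prod hb (hI.2 s hs c hc).1)
  · refine mem_mul_of_mem_span ?_ ha
    rintro _ ⟨b, hb, c, hc, rfl⟩
    rw [show b * c * s = b * (c * s) - c * (b * s) by rw [IsLeibniz.leibniz b c s]; abel]
    exact sub_mem (mul_mem_prod hb (hI.2 s hs c hc).2) (mul_mem_prod hc (hI.2 s hs b hb).2)

theorem IsMinimalIdeal.prod_self_eq_bot [IsLeibniz L] {S A : Submodule F L}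
    (hA : IsMinimalIdeal S A) (hS : IsSolvable S) : prod A A = ⊥ := by
  by_contra h
  refine hA.2.1 ((hS.mono hA.1.1).eq_bot_of_prod_self_eq
    (hA.2.2 _ hA.1.prod_self (prod_le.2 fun s hs t ht => (hA.1.2 s (hA.1.1 hs) t ht).1) h))

theorem sq_mul [IsLeibniz L] (x y : L) : x * x * y = 0 := by
  have := IsLeibniz.leibniz x x y
  simpa using this

theorem leib_mul [IsLeibniz L] {a : L} (ha : a ∈ leib F L) (x : L) : a * x = 0 := by
  have : a * x ∈ (⊥ : Submodule F L) := by
    refine mem_mul_of_mem_span ?_ ha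
    rintro _ ⟨y, rfl⟩
    simp [sq_mul]
  simpa using this

theorem isIdeal_leib [IsLeibniz L] : IsIdeal ⊤ (leib F L) := by
  refine ⟨le_top, fun s _ a ha => ⟨?_, ?_⟩⟩
  · refine mul_mem_of_mem_span ?_ ha
    rintro _ ⟨y, rfl⟩
    -- Polarization: the derivation rule gives `(sy)y + y(sy)`, the cross terms of `(sy + y)²`.
    have h : s * (y * y) = (s * y + y) * (s * y + y) - (s * y) * (s * y) - y * y := by
      rw [IsLeibniz.leibniz]
      simp only [mul_add, add_mul]
      abel
    rw [h]
    exact sub_mem (sub_mem (Submodule.subset_span ⟨_, rfl⟩) (Submodule.subset_span ⟨_, rfl⟩))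
      (Submodule.subset_span ⟨_, rfl⟩)
  · rw [leib_mul ha]
    exact zero_mem _

/-- The sum of a subspace closed under multiplication and an ideal is a subalgebra. -/
def supSubalgebra {A K : Submodule F L} (hA : IsIdeal ⊤ A) (hK : ∀ x ∈ K, ∀ y ∈ K, x * y ∈ K) :
    NonUnitalSubalgebra F L where
  toSubmodule := A ⊔ K
  mul_mem' := by
    intro x y hx hy
    obtain ⟨a, ha, k, hk, rfl⟩ := Submodule.mem_sup.1 hx
    obtain ⟨b, hb, l, hl, rfl⟩ := Submodule.mem_sup.1 hy
    have h : (a + k) * (b + l) = (a * (b + l) + k * b) + k * l := by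
      simp only [mul_add, add_mul]; abel
    rw [h]
    exact Submodule.add_mem_sup
      (add_mem (hA.2 _ trivial a ha).2 (hA.2 k trivial b hb).1) (hK k hk l hl)

theorem toSubmodule_supSubalgebra {A K : Submodule F L} (hA : IsIdeal ⊤ A)
    (hK : ∀ x ∈ K, ∀ y ∈ K, x * y ∈ K) : (supSubalgebra hA hK).toSubmodule = A ⊔ K := rfl

/-- Some maximal subalgebra `K` misses part of `A`, so `A + K = L`. Since `A` kills itself, `A ∩ K`
is an ideal of `L`, and minimality makes it zero. -/
theorem IsMinimalIdeal.exists_isCompl {A : Submodule F L} (hA : IsMinimalIdeal ⊤ A)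
    (hAA : prod A A = ⊥) (hfree : frattiniIdeal F L = ⊥) :
    ∃ K : NonUnitalSubalgebra F L, IsCompl A K.toSubmodule := by
  have h1 : ¬ A ≤ (frattiniSubalgebra F L).toSubmodule := fun h =>
    hA.2.1 (le_bot_iff.1 (hfree ▸ le_sSup ⟨hA.1, h⟩))
  obtain ⟨K, hK, hAK⟩ : ∃ K : NonUnitalSubalgebra F L, IsCoatom K ∧ ¬ A ≤ K.toSubmodule := by
    by_contra! h
    refine h1 fun a ha => ?_
    change a ∈ sInf {K : NonUnitalSubalgebra F L | IsCoatom K}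
    rw [NonUnitalAlgebra.mem_sInf]
    exact fun K hK => h K hK ha
  have hKm : ∀ x ∈ K.toSubmodule, ∀ y ∈ K.toSubmodule, x * y ∈ K.toSubmodule :=
    fun x hx y hy => K.mul_mem hx hy
  have htop : A ⊔ K.toSubmodule = ⊤ := by
    have h : K < supSubalgebra hA.1 hKm :=
      lt_of_le_of_ne (fun x hx => (le_sup_right : _ ≤ A ⊔ K.toSubmodule) hx) fun h => by
        apply hAK
        rw [h]
        exact le_sup_left
    rw [← toSubmodule_supSubalgebra hA.1 hKm, hK.2 _ h]
    rfl
  refine ⟨K, disjoint_iff.2 ?_, codisjoint_iff.2 htop⟩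
  by_contra hne
  refine hAK (inf_eq_left.1 (hA.2.2 _ ⟨le_top, fun s _ a ha => ?_⟩ inf_le_left hne))
  obtain ⟨b, hb, k, hk, rfl⟩ := Submodule.mem_sup.1 (htop ▸ Submodule.mem_top : s ∈ A ⊔ _)
  rw [prod_eq_bot] at hAA
  refine ⟨⟨(hA.1.2 _ trivial a ha.1).1, ?_⟩, ⟨(hA.1.2 _ trivial a ha.1).2, ?_⟩⟩
  · rw [add_mul, hAA b hb a ha.1, zero_add]
    exact K.mul_mem hk ha.2
  · rw [mul_add, hAA a ha.1 b hb, zero_add]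
    exact K.mul_mem ha.2 hk

theorem lowerCentralSeries_le_sup {A K : Submodule F L} (hA : IsIdeal ⊤ A) (h : A ⊔ K = ⊤)
    (n : ℕ) : lowerCentralSeries (prod ⊤ ⊤) n ≤ A ⊔ lowerCentralSeries (prod K K) n := by
  have key : ∀ S T S' T' : Submodule F L, S ≤ A ⊔ S' → T ≤ A ⊔ T' →
      prod S T ≤ A ⊔ prod S' T' := by
    intro S T S' T' hS hT
    refine prod_le.2 fun s hs t ht => ?_
    obtain ⟨a, ha, s', hs', rfl⟩ := Submodule.mem_sup.1 (hS hs)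
    obtain ⟨b, hb, t', ht', rfl⟩ := Submodule.mem_sup.1 (hT ht)
    have h : (a + s') * (b + t') = (a * (b + t') + s' * b) + s' * t' := by
      simp only [mul_add, add_mul]; abel
    rw [h]
    exact Submodule.add_mem_sup
      (add_mem (hA.2 _ trivial a ha).2 (hA.2 _ trivial b hb).1) (mul_mem_prod hs' ht')
  have h0 := key ⊤ ⊤ K K h.ge h.ge
  induction n with
  | zero => exact h0
  | succ n ih => exact key _ _ _ _ h0 ih

theorem exists_lowerCentralSeries_le {A : Submodule F L} {K : NonUnitalSubalgebra F L}
    (hmin : IsMinimallyNonStronglySolvable F L) (hA : IsIdeal ⊤ A) (hA0 : A ≠ ⊥)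
    (hK : IsCompl A K.toSubmodule) : ∃ n, lowerCentralSeries (prod ⊤ ⊤ : Submodule F L) n ≤ A := by
  have hKtop : K ≠ ⊤ := by
    rintro rfl
    exact hA0 (le_bot_iff.1 (hK.1 le_rfl fun _ _ => trivial))
  obtain ⟨n, hn⟩ := hmin.2 K hKtop
  refine ⟨n, (lowerCentralSeries_le_sup hA hK.sup_eq_top n).trans ?_⟩
  rw [hn, sup_bot_eq]

theorem isMinimalIdeal_unique [IsLeibniz L] (hsolv : IsSolvable (⊤ : Submodule F L))
    (hfree : frattiniIdeal F L = ⊥) (hmin : IsMinimallyNonStronglySolvable F L)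
    {A B : Submodule F L} (hA : IsMinimalIdeal ⊤ A) (hB : IsMinimalIdeal ⊤ B) : B = A := by
  obtain ⟨K, hK⟩ := hA.exists_isCompl (hA.prod_self_eq_bot hsolv) hfree
  obtain ⟨K', hK'⟩ := hB.exists_isCompl (hB.prod_self_eq_bot hsolv) hfree
  obtain ⟨n, hn⟩ := exists_lowerCentralSeries_le hmin hA.1 hA.2.1 hK
  obtain ⟨m, hm⟩ := exists_lowerCentralSeries_le hmin hB.1 hB.2.1 hK'
  have h1 := lowerCentralSeries_add_le (fun s _ a ha => (hA.1.2 s trivial a ha).1) hn m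
  have h2 := lowerCentralSeries_add_le (fun s _ a ha => (hB.1.2 s trivial a ha).1) hm n
  rw [add_comm] at h2
  have h3 : A ⊓ B ≠ ⊥ := fun h => hmin.1 ⟨n + m, le_bot_iff.1 (h ▸ le_inf h1 h2)⟩
  rw [← hA.2.2 _ (hA.1.inf hB.1) inf_le_left h3]
  exact (hB.2.2 _ (hA.1.inf hB.1) inf_le_right h3).symm

end Ideals

/-! ### Nilpotency of commutators in characteristic zero -/

section NilpotentDerivative

open Polynomial

variable {F E : Type*} [Field F] [Ring E] [Algebra F E]

theorem commutator_aeval {x y w : E} (hxy : x * y - y * x = w) (hw : Commute w y) (q : F[X]) :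
    x * aeval y q - aeval y q * x = aeval y (derivative q) * w := by
  have hpow : ∀ n : ℕ, x * y ^ n - y ^ n * x = (n : E) * y ^ (n - 1) * w := by
    intro n
    induction n with
    | zero => simp
    | succ n ih =>
      rcases n with _ | n
      · simpa using hxy
      · have h : x * y ^ (n + 1 + 1) - y ^ (n + 1 + 1) * x =
            (x * y ^ (n + 1) - y ^ (n + 1) * x) * y + y ^ (n + 1) * (x * y - y * x) := by
          rw [pow_succ y (n + 1)]; noncomm_ring
        rw [h, ih, hxy]
        simp only [Nat.add_sub_cancel]
        rw [mul_assoc _ w y, hw.eq]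
        push_cast
        rw [pow_succ y n]
        noncomm_ring
  induction q using Polynomial.induction_on' with
  | add p q hp hq =>
    simp only [map_add, add_mul, mul_add, ← hp, ← hq]
    abel
  | monomial n c =>
    simp only [derivative_monomial, aeval_monomial, map_mul, map_natCast]
    have hc := Algebra.commutes c x
    calc x * (algebraMap F E c * y ^ n) - algebraMap F E c * y ^ n * x
        = algebraMap F E c * (x * y ^ n - y ^ n * x) := by
          rw [← mul_assoc x, ← hc]; noncomm_ring
      _ = _ := by rw [hpow]; noncomm_ring

/-- If `w = [x, y]` commutes with `y` and with `[x, w]`, and `y` is algebraic over a field of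
characteristic zero, then `w` is nilpotent. -/
theorem isNilpotent_commutator [CharZero F] {x y w : E} (hxy : x * y - y * x = w)
    (hw : Commute w y) (hxw : Commute w (x * w - w * x)) (hy : IsAlgebraic F y) :
    _root_.IsNilpotent w := by
  -- Commuting `q(y) w ^ k = 0` with `x` and multiplying by `w` on the right gives `q'(y) w ^ (k +
  -- 2) = 0`: the other term is a multiple of `q(y) w ^ k [x, w]`. Differentiation continues down to
  -- a nonzero constant.
  have key : ∀ (n : ℕ) (q : F[X]) (k : ℕ), q.natDegree ≤ n → q ≠ 0 → aeval y q * w ^ k = 0 →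
      _root_.IsNilpotent w := by
    intro n
    induction n with
    | zero =>
      intro q k hq hq0 h
      obtain ⟨c, rfl⟩ := natDegree_eq_zero.1 (Nat.le_zero.1 hq)
      have hc : c ≠ 0 := by simpa using hq0
      refine ⟨k, ?_⟩
      have h' : c • w ^ k = 0 := by rwa [aeval_C, ← Algebra.smul_def] at h
      exact (smul_eq_zero_iff_right hc).1 h'
    | succ n ih =>
      intro q k hq hq0 h
      by_cases hd : q.natDegree = 0
      · exact ih q k (by omega) hq0 h
      have hd' : derivative q ≠ 0 := fun h0 =>
        hd (derivative_eq_zero.1 h0)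
      refine ih (derivative q) (k + 2) ?_ hd' ?_
      · have := natDegree_derivative_lt hd
        omega
      have h1 := commutator_aeval hxy hw q
      have h2 := commutator_aeval (F := F) (rfl : x * w - w * x = _) hxw.symm (X ^ k)
      set P := aeval y q
      set P' := aeval y (derivative q)
      set v := x * w - w * x
      rcases k with _ | k
      · have hP : P = 0 := by simpa using h
        rw [hP] at h1
        simp only [mul_zero, zero_mul, sub_zero] at h1
        rw [zero_add, pow_two, ← mul_assoc, ← h1, zero_mul]
      simp only [map_pow, aeval_X, derivative_X_pow, map_mul, aeval_C, Nat.add_sub_cancel] at h2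
      have e : P' * w ^ (k + 1 + 2) = P' * w * w ^ (k + 1) * w := by
        rw [mul_assoc P' w, ← pow_succ', mul_assoc, ← pow_succ]
      have e2 : (x * P - P * x) * w ^ (k + 1) =
          x * (P * w ^ (k + 1)) - P * w ^ (k + 1) * x
            - P * (x * w ^ (k + 1) - w ^ (k + 1) * x) := by noncomm_ring
      have e3 : P * (algebraMap F E ((k + 1 : ℕ) : F) * w ^ k * v) * w =
          algebraMap F E ((k + 1 : ℕ) : F) * (P * w ^ (k + 1) * v) := by
        have hc := Algebra.commutes ((k + 1 : ℕ) : F) P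
        calc _ = P * algebraMap F E ((k + 1 : ℕ) : F) * w ^ k * (v * w) := by
              simp only [mul_assoc]
          _ = _ := by rw [← hc, ← hxw.eq, pow_succ]; simp only [mul_assoc]
      rw [e, ← h1, e2, h, h2]
      simp only [mul_zero, zero_mul, sub_zero, zero_sub, neg_mul]
      rw [e3, h]
      simp
  obtain ⟨q, hq0, hq⟩ := hy
  exact key _ q 0 le_rfl hq0 (by simpa using hq)

end NilpotentDerivative

/-! ### Faithful irreducible action by left multiplication -/

section FaithfulIrreducible

variable {F L : Type*} [Field F] [NonUnitalNonAssocRing L] [Module F L]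

/-- Left multiplication by elements of `H` preserves `A`, and this action is faithful and
irreducible. -/
structure IsFaithfulIrreducible (H A : Submodule F L) : Prop where
  mul_mem : ∀ h ∈ H, ∀ a ∈ A, h * a ∈ A
  ne_bot : A ≠ ⊥
  faithful : ∀ h ∈ H, (∀ a ∈ A, h * a = 0) → h = 0
  irreducible : ∀ B ≤ A, (∀ h ∈ H, ∀ b ∈ B, h * b ∈ B) → B ≠ ⊥ → B = A

variable [IsScalarTower F L L] [SMulCommClass F L L]

/-- The annihilated part of `A` under left multiplication by `I`. -/
def annihilated (I A : Submodule F L) : Submodule F L where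
  carrier := {a | a ∈ A ∧ ∀ i ∈ I, i * a = 0}
  add_mem' := fun ha hb => ⟨add_mem ha.1 hb.1, fun i hi => by
    rw [mul_add, ha.2 i hi, hb.2 i hi, add_zero]⟩
  zero_mem' := ⟨zero_mem _, fun i _ => mul_zero i⟩
  smul_mem' := fun c a ha => ⟨A.smul_mem c ha.1, fun i hi => by
    rw [mul_smul_comm, ha.2 i hi, smul_zero]⟩

namespace IsFaithfulIrreducible

variable [IsLeibniz L] {H A : Submodule F L}

/-- As `I` is an ideal, the part of `A` that it kills is stable under `H`, hence is all of `A`;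
faithfulness finishes. -/
theorem eq_bot_of_annihilated_ne_bot (h : IsFaithfulIrreducible H A) {I : Submodule F L}
    (hI : IsIdeal H I) (hne : annihilated I A ≠ ⊥) : I = ⊥ := by
  have hA : annihilated I A = A := by
    refine h.irreducible _ (fun a ha => ha.1) (fun x hx a ha => ⟨h.mul_mem x hx a ha.1, ?_⟩) hne
    intro i hi
    rw [IsLeibniz.leibniz, ha.2 _ (hI.2 x hx i hi).2, ha.2 i hi, mul_zero, add_zero]
  rw [eq_bot_iff]
  intro i hi
  refine (Submodule.mem_bot F).2 (h.faithful i (hI.1 hi) fun a ha => ?_)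
  rw [← hA] at ha
  exact ha.2 i hi

theorem eq_bot_of_iteratedAction_eq_bot (h : IsFaithfulIrreducible H A) {I : Submodule F L}
    (hI : IsIdeal H I) {n : ℕ} (hn : iteratedAction I A n = ⊥) : I = ⊥ := by
  refine h.eq_bot_of_annihilated_ne_bot hI fun hbot => ?_
  have hle : ∀ k, iteratedAction I A k ≤ A := by
    intro k
    induction k with
    | zero => exact le_rfl
    | succ k ih => exact prod_le.2 fun s hs t ht => h.mul_mem s (hI.1 hs) t (ih ht)
  induction n with
  | zero => exact h.ne_bot hn
  | succ n ih =>
    refine ih (le_bot_iff.1 (hbot ▸ fun a ha => ⟨hle n ha, fun i hi => ?_⟩))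
    exact prod_eq_bot.1 hn i hi a ha

/-- In a minimal nonzero `N`-stable subspace of `A`, the kernel of each `m ∈ N` is nonzero, and
`N`-stable because `N` is abelian. So `N` kills that subspace. -/
theorem eq_bot_of_isNilpotent [FiniteDimensional F L] (h : IsFaithfulIrreducible H A)
    {N : Submodule F L} (hN : IsIdeal H N) (hNN : prod N N = ⊥)
    (hnil : ∀ m ∈ N, _root_.IsNilpotent (LinearMap.mulLeft F m)) : N = ⊥ := by
  refine h.eq_bot_of_annihilated_ne_bot hN ?_
  obtain ⟨B, ⟨hBA, hB0, hBN⟩, hBmin⟩ := (wellFounded_lt (α := Submodule F L)).has_min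
    {B | B ≤ A ∧ B ≠ ⊥ ∧ ∀ m ∈ N, ∀ b ∈ B, m * b ∈ B}
    ⟨A, le_rfl, h.ne_bot, fun m hm a ha => h.mul_mem m (hN.1 hm) a ha⟩
  rw [prod_eq_bot] at hNN
  have hkill : ∀ m ∈ N, ∀ b ∈ B, m * b = 0 := by
    intro m hm
    have hker : B ⊓ LinearMap.ker (LinearMap.mulLeft F m) ≠ ⊥ := by
      intro hbot
      obtain ⟨k, hk⟩ := hnil m hm
      obtain ⟨b, hb, hb0⟩ := Submodule.exists_mem_ne_zero_of_ne_bot hB0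
      have hstep : ∀ k, (LinearMap.mulLeft F m ^ k) b ∈ B ∧
          (LinearMap.mulLeft F m ^ k) b ≠ 0 := by
        intro k
        induction k with
        | zero => exact ⟨hb, hb0⟩
        | succ k ih =>
          rw [pow_succ', Module.End.mul_apply]
          refine ⟨hBN m hm _ ih.1, fun h0 => ih.2 ?_⟩
          have : (LinearMap.mulLeft F m ^ k) b ∈ B ⊓ LinearMap.ker (LinearMap.mulLeft F m) :=
            ⟨ih.1, h0⟩
          rwa [hbot, Submodule.mem_bot] at this
      exact (hstep k).2 (by rw [hk]; rfl)
    have heq : B ⊓ LinearMap.ker (LinearMap.mulLeft F m) = B := by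
      by_contra hne
      refine hBmin _ ⟨inf_le_left.trans hBA, hker, fun m' hm' b hb => ⟨hBN m' hm' b hb.1, ?_⟩⟩
        (lt_of_le_of_ne inf_le_left hne)
      have hb2 : m * b = 0 := hb.2
      change m * (m' * b) = 0
      rw [IsLeibniz.leibniz, hNN m hm m' hm', hb2, zero_mul, mul_zero, add_zero]
    intro b hb
    rw [← heq] at hb
    exact hb.2
  intro hbot
  exact hB0 (le_bot_iff.1 (hbot ▸ fun b hb => ⟨hBA hb, fun m hm => hkill m hm b hb⟩))


theorem eq_bot_of_charZero [CharZero F] [FiniteDimensional F L] (h : IsFaithfulIrreducible H A)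
    {N : Submodule F L} (hN : IsIdeal H N) (hNN : prod N N = ⊥)
    (hcomm : ∀ m ∈ N, ∃ x ∈ H, ∃ y, x * y = m ∧ m * y = 0) : N = ⊥ := by
  refine h.eq_bot_of_isNilpotent hN hNN fun m hm => ?_
  obtain ⟨x, hx, y, hxy, hmy⟩ := hcomm m hm
  rw [prod_eq_bot] at hNN
  have hbr : ∀ a b : L, LinearMap.mulLeft F a * LinearMap.mulLeft F b
      - LinearMap.mulLeft F b * LinearMap.mulLeft F a = LinearMap.mulLeft F (a * b) := by
    intro a b
    ext c
    simp [IsLeibniz.leibniz a b c]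
  refine isNilpotent_commutator (F := F) (x := LinearMap.mulLeft F x)
    (y := LinearMap.mulLeft F y) (by rw [hbr, hxy]) ?_ ?_ (Algebra.IsAlgebraic.isAlgebraic _)
  · rw [Commute, SemiconjBy, ← sub_eq_zero, hbr, hmy]
    ext; simp
  · rw [Commute, SemiconjBy, hbr, ← sub_eq_zero, hbr, hNN m hm _ (hN.2 x hx m hm).1]
    ext; simp

end IsFaithfulIrreducible

end FaithfulIrreducible


/-! ### Classification of `H` -/

section Classification

variable {F L : Type*} [Field F] [NonUnitalNonAssocRing L] [Module F L]

theorem isIdeal_of_prod_self_le {H S : Submodule F L} (h1 : prod H H ≤ S) (h2 : S ≤ H) :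
    IsIdeal H S :=
  ⟨h2, fun _ hs _ ha => ⟨h1 (mul_mem_prod hs (h2 ha)), h1 (mul_mem_prod (h2 ha) hs)⟩⟩

theorem IsLie.mul_eq_neg {H : Submodule F L} (hH : IsLie H) {x y : L} (hx : x ∈ H) (hy : y ∈ H) :
    x * y = -(y * x) := by
  have h := hH _ (add_mem hx hy)
  rw [add_mul, mul_add, mul_add, hH x hx, hH y hy, zero_add, add_zero] at h
  exact eq_neg_of_add_eq_zero_left h

variable [IsScalarTower F L L] [SMulCommClass F L L]

/-- The squares of the proper subalgebras of `H` act nilpotently on `A` from the left. -/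
def ProperSquaresActNilpotently (H A : Submodule F L) : Prop :=
  ∀ K ≤ H, K ≠ H → (∀ x ∈ K, ∀ y ∈ K, x * y ∈ K) → ∃ n, iteratedAction (prod K K) A n = ⊥

variable [IsLeibniz L] {H A : Submodule F L}

namespace IsFaithfulIrreducible

theorem prod_self_eq_bot_of_isIdeal (h : IsFaithfulIrreducible H A)
    (hK : ProperSquaresActNilpotently H A) {I : Submodule F L} (hI : IsIdeal H I) (hne : I ≠ H) :
    prod I I = ⊥ := by
  obtain ⟨n, hn⟩ := hK I hI.1 hne fun x hx y hy => (hI.2 x (hI.1 hx) y hy).1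
  exact h.eq_bot_of_iteratedAction_eq_bot hI.prod_self hn

theorem two_le_finrank [FiniteDimensional F L] (h : IsFaithfulIrreducible H A)
    (hH : ∀ x ∈ H, ∀ y ∈ H, x * y ∈ H) (hN : prod H H ≠ ⊥) : 2 ≤ Module.finrank F A := by
  by_contra! hlt
  have h0 : Module.finrank F A ≠ 0 := fun h0 => h.ne_bot (Submodule.finrank_eq_zero.1 h0)
  obtain ⟨⟨a, ha⟩, -, hspan⟩ := finrank_eq_one_iff'.1 (show Module.finrank F A = 1 by omega)
  have hs : ∀ x ∈ A, ∃ c : F, c • a = x := fun x hx => by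
    obtain ⟨c, hc⟩ := hspan ⟨x, hx⟩
    exact ⟨c, congrArg Subtype.val hc⟩
  refine hN (prod_eq_bot.2 fun x hx y hy => h.faithful _ (hH x hx y hy) fun b hb => ?_)
  obtain ⟨c, hc⟩ := hs _ (h.mul_mem x hx a ha)
  obtain ⟨d, hd⟩ := hs _ (h.mul_mem y hy a ha)
  obtain ⟨e, rfl⟩ := hs b hb
  have hl := IsLeibniz.leibniz x y a
  rw [← hd, ← hc, mul_smul_comm, mul_smul_comm, ← hc, ← hd, smul_smul, smul_smul, mul_comm] at hl
  rw [mul_smul_comm, right_eq_add.1 hl, smul_zero]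

section Line

variable {u : L}

/-- If `H` is spanned by `H * H` and `u`, then left multiplication by `u` maps `H * H` onto
itself. -/
theorem exists_mul_eq (h : IsFaithfulIrreducible H A) (hK : ProperSquaresActNilpotently H A)
    (hH : ∀ x ∈ H, ∀ y ∈ H, x * y ∈ H) (hLie : IsLie H) (hNH : prod H H ≠ H) (hu : u ∈ H)
    (hline : prod H H ⊔ Submodule.span F {u} = H) {m : L} (hm : m ∈ prod H H) :
    ∃ y ∈ prod H H, u * y = m := by
  have hNN := prod_eq_bot.1 (h.prod_self_eq_bot_of_isIdeal hK
    (isIdeal_of_prod_self_le le_rfl (prod_le.2 hH)) hNH)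
  have hle : prod H H ≤ (prod H H).map (LinearMap.mulLeft F u) := by
    refine prod_le.2 fun s hs t ht => ?_
    rw [← hline] at hs ht
    obtain ⟨a, ha, _, hs', rfl⟩ := Submodule.mem_sup.1 hs
    obtain ⟨c, rfl⟩ := Submodule.mem_span_singleton.1 hs'
    obtain ⟨b, hb, _, ht', rfl⟩ := Submodule.mem_sup.1 ht
    obtain ⟨d, rfl⟩ := Submodule.mem_span_singleton.1 ht'
    -- Since `ab = 0`, `uu = 0` and `au = -ua`, the product `(a + cu)(b + du)` equals `u(cb - da)`.
    refine ⟨c • b - d • a, sub_mem (Submodule.smul_mem _ _ hb) (Submodule.smul_mem _ _ ha), ?_⟩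
    simp only [LinearMap.mulLeft_apply, mul_sub, add_mul, mul_add, mul_smul_comm, smul_mul_assoc,
      hNN a ha b hb, hLie u hu, hLie.mul_eq_neg (prod_le.2 hH ha) hu, smul_zero]
    module
  obtain ⟨y, hy, hym⟩ := hle hm
  exact ⟨y, hy, hym⟩

/-- For a smaller nonzero ideal `J`, `J + Fu` is a proper subalgebra whose square contains `uJ`.
This `uJ` is an ideal of `H` acting nilpotently, so it vanishes, although `u` is injective on `H²`.
-/
theorem isMinimalIdeal_prod_self [FiniteDimensional F L] (h : IsFaithfulIrreducible H A)
    (hK : ProperSquaresActNilpotently H A) (hH : ∀ x ∈ H, ∀ y ∈ H, x * y ∈ H) (hLie : IsLie H)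
    (hN : prod H H ≠ ⊥) (hNH : prod H H ≠ H) (hu : u ∈ H)
    (hline : prod H H ⊔ Submodule.span F {u} = H) : IsMinimalIdeal H (prod H H) := by
  have hNid := isIdeal_of_prod_self_le le_rfl (prod_le.2 hH)
  have hNN := prod_eq_bot.1 (h.prod_self_eq_bot_of_isIdeal hK hNid hNH)
  have huN : u ∉ prod H H := fun hu' => hNH (by
    rwa [sup_eq_left.2 ((Submodule.span_singleton_le_iff_mem _ _).2 hu')] at hline)
  have hinj : ∀ y ∈ prod H H, u * y = 0 → y = 0 := by
    let f : prod H H →ₗ[F] prod H H :=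
      (LinearMap.mulLeft F u).restrict fun y hy => (hNid.2 u hu y hy).1
    have hf : Function.Surjective f := by
      rintro ⟨m, hm⟩
      obtain ⟨y, hy, hym⟩ := h.exists_mul_eq hK hH hLie hNH hu hline hm
      exact ⟨⟨y, hy⟩, Subtype.ext hym⟩
    intro y hy h0
    have := LinearMap.injective_iff_surjective.2 hf
      (a₁ := ⟨y, hy⟩) (a₂ := 0) (by rw [map_zero]; exact Subtype.ext h0)
    exact congrArg Subtype.val this
  refine ⟨hNid, hN, fun J hJ hJN hJ0 => ?_⟩
  by_contra hne
  have hKH : J ⊔ Submodule.span F {u} ≤ H :=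
    sup_le hJ.1 ((Submodule.span_singleton_le_iff_mem _ _).2 hu)
  have hKne : J ⊔ Submodule.span F {u} ≠ H := by
    intro heq
    refine hne (le_antisymm hJN fun n hn => ?_)
    obtain ⟨j, hj, _, hs, rfl⟩ := Submodule.mem_sup.1 (heq ▸ hNid.1 hn)
    obtain ⟨c, rfl⟩ := Submodule.mem_span_singleton.1 hs
    have hc : c • u ∈ prod H H := (Submodule.add_mem_iff_right _ (hJN hj)).1 hn
    have hc0 : c = 0 := by
      by_contra hc0
      exact huN ((Submodule.smul_mem_iff _ hc0).1 hc)
    simpa [hc0] using hj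
  have hKmul : ∀ x ∈ J ⊔ Submodule.span F {u}, ∀ y ∈ J ⊔ Submodule.span F {u},
      x * y ∈ J ⊔ Submodule.span F {u} := by
    intro x hx y hy
    obtain ⟨j, hj, _, hs, rfl⟩ := Submodule.mem_sup.1 hx
    obtain ⟨c, rfl⟩ := Submodule.mem_span_singleton.1 hs
    rw [add_mul]
    refine Submodule.mem_sup_left (add_mem (hJ.2 y (hKH hy) j hj).2 ?_)
    obtain ⟨j', hj', _, hs', rfl⟩ := Submodule.mem_sup.1 hy
    obtain ⟨d, rfl⟩ := Submodule.mem_span_singleton.1 hs'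
    rw [mul_add, smul_mul_smul_comm, hLie u hu, smul_zero, add_zero, smul_mul_assoc]
    exact J.smul_mem _ (hJ.2 u hu j' hj').1
  obtain ⟨n, hn⟩ := hK _ hKH hKne hKmul
  -- In `s(uj) = (su)j + u(sj)` the first term vanishes, both factors lying in the abelian ideal
  -- `H²`.
  have hU : IsIdeal H (J.map (LinearMap.mulLeft F u)) := by
    have hUJ : J.map (LinearMap.mulLeft F u) ≤ J := by
      rintro _ ⟨j, hj, rfl⟩
      exact (hJ.2 u hu j hj).1
    have hleft : ∀ s ∈ H, ∀ a ∈ J.map (LinearMap.mulLeft F u),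
        s * a ∈ J.map (LinearMap.mulLeft F u) := by
      rintro s hs _ ⟨j, hj, rfl⟩
      refine ⟨s * j, (hJ.2 s hs j hj).1, ?_⟩
      simp only [LinearMap.mulLeft_apply]
      rw [IsLeibniz.leibniz s u j, hNN _ (mul_mem_prod hs hu) j (hJN hj), zero_add]
    refine ⟨hUJ.trans hJ.1, fun s hs a ha => ⟨hleft s hs a ha, ?_⟩⟩
    rw [hLie.mul_eq_neg (hJ.1 (hUJ ha)) hs]
    exact neg_mem (hleft s hs a ha)
  have hUK : J.map (LinearMap.mulLeft F u) ≤
      prod (J ⊔ Submodule.span F {u}) (J ⊔ Submodule.span F {u}) := by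
    rintro _ ⟨j, hj, rfl⟩
    exact mul_mem_prod (Submodule.mem_sup_right (Submodule.mem_span_singleton_self u))
      (Submodule.mem_sup_left hj)
  have hU0 := h.eq_bot_of_iteratedAction_eq_bot hU
    (le_bot_iff.1 ((iteratedAction_mono hUK A n).trans hn.le))
  refine hJ0 ((Submodule.eq_bot_iff _).2 fun j hj => hinj j (hJN hj) ?_)
  have : u * j ∈ J.map (LinearMap.mulLeft F u) := ⟨j, hj, rfl⟩
  rwa [hU0, Submodule.mem_bot] at this

theorem isMinimalAbelianPlusLine [FiniteDimensional F L] (h : IsFaithfulIrreducible H A)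
    (hK : ProperSquaresActNilpotently H A) (hH : ∀ x ∈ H, ∀ y ∈ H, x * y ∈ H) (hLie : IsLie H)
    (hN : prod H H ≠ ⊥) (hNH : prod H H ≠ H) (hu : u ∈ H)
    (hline : prod H H ⊔ Submodule.span F {u} = H) : IsMinimalAbelianPlusLine H := by
  have huN : u ∉ prod H H := fun hu' => hNH (by
    rwa [sup_eq_left.2 ((Submodule.span_singleton_le_iff_mem _ _).2 hu')] at hline)
  have hu0 : u ≠ 0 := by
    rintro rfl
    exact huN (zero_mem _)
  exact ⟨prod H H, u, h.isMinimalIdeal_prod_self hK hH hLie hN hNH hu hline,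
    h.prod_self_eq_bot_of_isIdeal hK (isIdeal_of_prod_self_le le_rfl (prod_le.2 hH)) hNH, hu0,
    (Submodule.disjoint_span_singleton' hu0).2 huN, hline⟩

end Line

theorem mul_eq_zero_of_mem_prod_self (h : IsFaithfulIrreducible H A)
    (hK : ProperSquaresActNilpotently H A) (hH : ∀ x ∈ H, ∀ y ∈ H, x * y ∈ H)
    (hline : ∀ u ∈ H, prod H H ⊔ Submodule.span F {u} ≠ H) {m u : L} (hm : m ∈ prod H H)
    (hu : u ∈ H) : u * m = 0 ∧ m * u = 0 := by
  have hab := prod_eq_bot.1 (h.prod_self_eq_bot_of_isIdeal hK (isIdeal_of_prod_self_le le_sup_left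
    (sup_le (prod_le.2 hH) ((Submodule.span_singleton_le_iff_mem _ _).2 hu))) (hline u hu))
  have hm' : m ∈ prod H H ⊔ Submodule.span F {u} := Submodule.mem_sup_left hm
  have hu' : u ∈ prod H H ⊔ Submodule.span F {u} :=
    Submodule.mem_sup_right (Submodule.mem_span_singleton_self u)
  exact ⟨hab u hu' m hm', hab m hm' u hu'⟩

/-- If `xy ≠ 0`, the ideal `H² + Fx + Fy` is not abelian, so it is all of `H`. With `H²` central,
every product is then a multiple of `xy`. -/
theorem exists_prod_self_eq_span (h : IsFaithfulIrreducible H A)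
    (hK : ProperSquaresActNilpotently H A) (hH : ∀ x ∈ H, ∀ y ∈ H, x * y ∈ H) (hLie : IsLie H)
    (hN : prod H H ≠ ⊥) (hline : ∀ u ∈ H, prod H H ⊔ Submodule.span F {u} ≠ H) :
    ∃ x ∈ H, ∃ y ∈ H, x * y ≠ 0 ∧ prod H H = Submodule.span F {x * y} ∧
      Submodule.span F {x, y, x * y} = H := by
  obtain ⟨x, hx, y, hy, hxy⟩ : ∃ x ∈ H, ∃ y ∈ H, x * y ≠ 0 := by
    by_contra! h0
    exact hN (prod_eq_bot.2 h0)
  have hz := fun {m u : L} => h.mul_eq_zero_of_mem_prod_self hK hH hline (m := m) (u := u)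
  have hle : prod H H ⊔ Submodule.span F {x, y} ≤ H :=
    sup_le (prod_le.2 hH) (Submodule.span_le.2 (by rintro _ (rfl | rfl) <;> assumption))
  have htop : prod H H ⊔ Submodule.span F {x, y} = H := by
    by_contra hne
    exact hxy (prod_eq_bot.1 (h.prod_self_eq_bot_of_isIdeal hK
      (isIdeal_of_prod_self_le le_sup_left hle) hne) x
      (Submodule.mem_sup_right (Submodule.subset_span (by simp))) y
      (Submodule.mem_sup_right (Submodule.subset_span (by simp))))
  have hNz : prod H H = Submodule.span F {x * y} := by
    refine le_antisymm (prod_le.2 fun s hs t ht => ?_)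
      ((Submodule.span_singleton_le_iff_mem _ _).2 (mul_mem_prod hx hy))
    obtain ⟨n, hn, s', hs', rfl⟩ := Submodule.mem_sup.1 (htop.symm ▸ hs :)
    obtain ⟨n', hn', t', ht', rfl⟩ := Submodule.mem_sup.1 (htop.symm ▸ ht :)
    rw [add_mul, (hz hn ht).2, zero_add, mul_add,
      (hz hn' (hle (Submodule.mem_sup_right hs'))).1, zero_add]
    obtain ⟨a, b, rfl⟩ := Submodule.mem_span_pair.1 hs'
    obtain ⟨c, d, rfl⟩ := Submodule.mem_span_pair.1 ht'
    refine Submodule.mem_span_singleton.2 ⟨a * d - b * c, ?_⟩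
    simp only [add_mul, mul_add, smul_mul_smul_comm, hLie x hx, hLie y hy,
      hLie.mul_eq_neg hy hx, smul_zero, smul_neg, sub_smul]
    abel
  refine ⟨x, hx, y, hy, hxy, hNz, ?_⟩
  rw [← htop, hNz, ← Submodule.span_union]
  congr 1
  ext w
  simp

theorem isHeisenberg (h : IsFaithfulIrreducible H A)
    (hK : ProperSquaresActNilpotently H A) (hH : ∀ x ∈ H, ∀ y ∈ H, x * y ∈ H) (hLie : IsLie H)
    (hN : prod H H ≠ ⊥) (hline : ∀ u ∈ H, prod H H ⊔ Submodule.span F {u} ≠ H) :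
    IsHeisenberg H := by
  obtain ⟨x, hx, y, hy, hxy, hNz, hspan⟩ := h.exists_prod_self_eq_span hK hH hLie hN hline
  have hz := fun {u : L} (hu : u ∈ H) =>
    h.mul_eq_zero_of_mem_prod_self hK hH hline (mul_mem_prod hx hy) hu
  refine ⟨x, y, x * y, ?_, hspan, rfl, hLie.mul_eq_neg hy hx, hLie x hx, hLie y hy,
    hLie _ (hH x hx y hy), (hz hx).1, (hz hx).2, (hz hy).1, (hz hy).2⟩
  rw [Fintype.linearIndependent_iff]
  intro g hg
  rw [Fin.sum_univ_three] at hg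
  simp only [Matrix.cons_val] at hg
  -- Right multiplication by `y` leaves only the `x` term of the relation.
  have h0 : g 0 = 0 := by
    have := congrArg (· * y) hg
    simpa [add_mul, smul_mul_assoc, hLie y hy, (hz hy).2, hxy] using this
  have h1 : g 1 = 0 := by
    have := congrArg (x * ·) hg
    simpa [mul_add, mul_smul_comm, hLie x hx, (hz hx).1, hxy] using this
  have h2 : g 2 = 0 := by simpa [h0, h1, hxy] using hg
  intro i
  fin_cases i <;> assumption

theorem not_charZero [FiniteDimensional F L] (h : IsFaithfulIrreducible H A)
    (hK : ProperSquaresActNilpotently H A) (hH : ∀ x ∈ H, ∀ y ∈ H, x * y ∈ H) (hLie : IsLie H)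
    (hN : prod H H ≠ ⊥) (hNH : prod H H ≠ H) : ¬ CharZero F := by
  intro _
  have hNid := isIdeal_of_prod_self_le le_rfl (prod_le.2 hH)
  have hNN := h.prod_self_eq_bot_of_isIdeal hK hNid hNH
  refine hN (h.eq_bot_of_charZero hNid hNN fun m hm => ?_)
  by_cases hline : ∃ u ∈ H, prod H H ⊔ Submodule.span F {u} = H
  · obtain ⟨u, hu, hline⟩ := hline
    obtain ⟨y, hy, hym⟩ := h.exists_mul_eq hK hH hLie hNH hu hline hm
    exact ⟨u, hu, y, hym, prod_eq_bot.1 hNN m hm y hy⟩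
  · push Not at hline
    obtain ⟨x, hx, y, hy, -, hNz, -⟩ := h.exists_prod_self_eq_span hK hH hLie hN hline
    obtain ⟨c, rfl⟩ := Submodule.mem_span_singleton.1 (hNz ▸ hm)
    exact ⟨x, hx, c • y, mul_smul_comm _ _ _,
      (h.mul_eq_zero_of_mem_prod_self hK hH hline hm (H.smul_mem c hy)).2⟩

theorem isMinimalAbelianPlusLine_or_isHeisenberg [FiniteDimensional F L]
    (h : IsFaithfulIrreducible H A) (hK : ProperSquaresActNilpotently H A)
    (hH : ∀ x ∈ H, ∀ y ∈ H, x * y ∈ H) (hLie : IsLie H)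
    (hN : prod H H ≠ ⊥) (hNH : prod H H ≠ H) : IsMinimalAbelianPlusLine H ∨ IsHeisenberg H := by
  by_cases hline : ∃ u ∈ H, prod H H ⊔ Submodule.span F {u} = H
  · obtain ⟨u, hu, hline⟩ := hline
    exact Or.inl (h.isMinimalAbelianPlusLine hK hH hLie hN hNH hu hline)
  · push Not at hline
    exact Or.inr (h.isHeisenberg hK hH hLie hN hline)

end IsFaithfulIrreducible

end Classification

/-! ### The action of the complement on the minimal ideal -/

section Structure

variable {F L : Type*} [Field F] [NonUnitalNonAssocRing L] [Module F L]
  [IsScalarTower F L L] [SMulCommClass F L L] [IsLeibniz L]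

/-- A nonzero `Leib(L)` contains a minimal ideal, which can only be `A`, and squares annihilate `L`
from the left. -/
theorem isLie_top_or_mul_eq_zero [FiniteDimensional F L] {A : Submodule F L}
    (hA : ∀ B : Submodule F L, IsMinimalIdeal ⊤ B → B = A) :
    IsLie (⊤ : Submodule F L) ∨ (A ≤ leib F L ∧ ∀ a ∈ A, ∀ x : L, a * x = 0) := by
  by_cases h : leib F L = ⊥
  · left
    intro x _
    have : x * x ∈ leib F L := Submodule.subset_span ⟨x, rfl⟩
    rwa [h, Submodule.mem_bot] at this
  · right
    obtain ⟨B, hB, hBmin⟩ := exists_isMinimalIdeal_le isIdeal_leib h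
    rw [hA B hBmin] at hB
    exact ⟨hB, fun a ha x => leib_mul (hB ha) x⟩

/-- Right multiplication on `A` is either minus left multiplication or zero, so left conditions
suffice. The left annihilator of `A` in `H` is thus an ideal of `L` meeting `A` in zero, and
vanishes by uniqueness of `A`. -/
theorem isFaithfulIrreducible_of_isCompl [FiniteDimensional F L] {A : Submodule F L}
    {H : NonUnitalSubalgebra F L} (hAmin : IsMinimalIdeal ⊤ A) (hAA : prod A A = ⊥)
    (hA : ∀ B : Submodule F L, IsMinimalIdeal ⊤ B → B = A) (hH : IsCompl A H.toSubmodule) :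
    IsFaithfulIrreducible H.toSubmodule A := by
  have hright : ∀ x a : L, a ∈ A → ∀ B : Submodule F L, x * a ∈ B → a * x ∈ B := by
    intro x a ha B hB
    rcases isLie_top_or_mul_eq_zero hA with h | h
    · rw [h.mul_eq_neg trivial trivial]
      exact neg_mem hB
    · rw [h.2 a ha]
      exact zero_mem B
  have hright0 : ∀ x a : L, a ∈ A → x * a = 0 → a * x = 0 := fun x a ha h0 => by
    simpa using hright x a ha ⊥ (by simpa using h0)
  have hdec : ∀ s : L, ∃ a ∈ A, ∃ h ∈ H, a + h = s := fun s =>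
    Submodule.mem_sup.1 (hH.sup_eq_top ▸ Submodule.mem_top : s ∈ A ⊔ H.toSubmodule)
  rw [prod_eq_bot] at hAA
  refine ⟨fun h _ a ha => (hAmin.1.2 h trivial a ha).1, hAmin.2.1, fun x hx hx0 => ?_,
    fun B hB hBH hB0 => ?_⟩
  · let C : Submodule F L :=
      { carrier := {c | c ∈ H ∧ ∀ a ∈ A, c * a = 0}
        add_mem' := fun ha hb => ⟨add_mem ha.1 hb.1, fun i hi => by
          rw [add_mul, ha.2 i hi, hb.2 i hi, add_zero]⟩
        zero_mem' := ⟨zero_mem _, fun i _ => zero_mul i⟩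
        smul_mem' := fun c a ha => ⟨H.toSubmodule.smul_mem c ha.1, fun i hi => by
          rw [smul_mul_assoc, ha.2 i hi, smul_zero]⟩ }
    have hC : IsIdeal ⊤ C := by
      refine ⟨le_top, fun s _ c hc => ?_⟩
      obtain ⟨b, hb, h, hh, rfl⟩ := hdec s
      rw [add_mul, mul_add, hc.2 b hb, hright0 c b hb (hc.2 b hb), zero_add, zero_add]
      refine ⟨⟨H.mul_mem hh hc.1, fun a ha => ?_⟩, ⟨H.mul_mem hc.1 hh, fun a ha => ?_⟩⟩
      · have := IsLeibniz.leibniz h c a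
        rwa [hc.2 a ha, hc.2 _ (hAmin.1.2 h trivial a ha).1, mul_zero, add_zero, eq_comm] at this
      · have := IsLeibniz.leibniz c h a
        rwa [hc.2 a ha, hc.2 _ (hAmin.1.2 h trivial a ha).1, mul_zero, add_zero, eq_comm] at this
    by_contra hxne
    have hC0 : C ≠ ⊥ := fun h0 => hxne (by
      have : x ∈ C := ⟨hx, hx0⟩
      rwa [h0, Submodule.mem_bot] at this)
    obtain ⟨B, hBC, hB⟩ := exists_isMinimalIdeal_le hC hC0
    rw [hA B hB] at hBC
    exact hAmin.2.1 (le_bot_iff.1 (hH.1 le_rfl fun a ha => (hBC ha).1))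
  · refine hAmin.2.2 B ⟨le_top, fun s _ b hb => ?_⟩ hB hB0
    have hs : s * b ∈ B := by
      obtain ⟨a, ha, h, hh, rfl⟩ := hdec s
      rw [add_mul, hAA a ha b (hB hb), zero_add]
      exact hBH h hh b hb
    exact ⟨hs, hright s b (hB hb) B hs⟩

theorem isLie_or_eq_leib [FiniteDimensional F L] {A : Submodule F L}
    {H : NonUnitalSubalgebra F L} (hAmin : IsMinimalIdeal ⊤ A) (hAA : prod A A = ⊥)
    (hA : ∀ B : Submodule F L, IsMinimalIdeal ⊤ B → B = A) (hH : IsCompl A H.toSubmodule) :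
    IsLie (⊤ : Submodule F L) ∨
      (IsLie H.toSubmodule ∧ A = leib F L ∧ prod A (⊤ : Submodule F L) = ⊥) := by
  refine (isLie_top_or_mul_eq_zero hA).imp_right fun ⟨hle, h0⟩ => ?_
  have hirr := isFaithfulIrreducible_of_isCompl hAmin hAA hA hH
  have hLie : IsLie H.toSubmodule := fun x hx =>
    hirr.faithful _ (H.mul_mem hx hx) fun a _ => sq_mul x a
  refine ⟨hLie, le_antisymm hle (Submodule.span_le.2 ?_), prod_eq_bot.2 fun a ha x _ => h0 a ha x⟩
  rintro _ ⟨s, rfl⟩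
  obtain ⟨a, ha, h, hh, rfl⟩ :=
    Submodule.mem_sup.1 (hH.sup_eq_top ▸ Submodule.mem_top : s ∈ A ⊔ H.toSubmodule)
  rw [add_mul, h0 a ha, zero_add, mul_add, hLie h hh, add_zero]
  exact (hAmin.1.2 h trivial a ha).1

theorem properSquaresActNilpotently_of_isCompl {A : Submodule F L} {H : NonUnitalSubalgebra F L}
    (hmin : IsMinimallyNonStronglySolvable F L) (hA : IsIdeal ⊤ A)
    (hH : IsCompl A H.toSubmodule) : ProperSquaresActNilpotently H.toSubmodule A := by
  intro K hKH hne hK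
  have hproper : supSubalgebra hA hK ≠ ⊤ := by
    intro htop
    have hsup : A ⊔ K = ⊤ := by
      rw [← toSubmodule_supSubalgebra hA hK, htop]
      rfl
    -- Modular law: `K ≤ H` are both complements of `A`, hence equal.
    refine hne (eq_of_le_of_inf_le_of_le_sup hKH (z := A) ?_ ?_)
    · rw [inf_comm, hH.inf_eq_bot]
      exact bot_le
    · rw [sup_comm, hsup]
      exact le_top
  obtain ⟨n, hn⟩ := hmin.2 _ hproper
  rw [toSubmodule_supSubalgebra] at hn
  have key : ∀ n, iteratedAction (prod K K) A (n + 1) ≤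
      lowerCentralSeries (prod (A ⊔ K) (A ⊔ K)) n := by
    intro n
    induction n with
    | zero => exact prod_mono ((prod_le.2 hK).trans le_sup_right) le_sup_left
    | succ n ih => exact prod_mono (prod_mono le_sup_right le_sup_right) ih
  exact ⟨n + 1, le_bot_iff.1 ((key n).trans hn.le)⟩

theorem prod_self_ne_bot_of_isCompl {A : Submodule F L} {H : NonUnitalSubalgebra F L}
    (hmin : IsMinimallyNonStronglySolvable F L) (hA : IsIdeal ⊤ A) (hAA : prod A A = ⊥)
    (hH : IsCompl A H.toSubmodule) : prod H.toSubmodule H.toSubmodule ≠ ⊥ := by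
  intro h0
  have hle := lowerCentralSeries_le_sup hA hH.sup_eq_top 0
  rw [lowerCentralSeries, lowerCentralSeries, h0, sup_bot_eq] at hle
  exact hmin.1 ⟨1, le_bot_iff.1 ((prod_mono hle hle).trans hAA.le)⟩

end Structure

end Leibniz

/-! ### The structure theorem -/

theorem mainTheorem1 {F L : Type*} [Field F] [NonUnitalNonAssocRing L] [Module F L]
    [IsScalarTower F L L] [SMulCommClass F L L] [FiniteDimensional F L] [IsLeibniz L]
    (hsolv : Leibniz.IsSolvable (⊤ : Submodule F L))
    (hfree : Leibniz.frattiniIdeal F L = ⊥)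
    (hmin : Leibniz.IsMinimallyNonStronglySolvable F L) :
    (∃ p : ℕ, p.Prime ∧ CharP F p) ∧
    ∃ (A : Submodule F L) (H : NonUnitalSubalgebra F L),
      IsCompl A H.toSubmodule ∧
      Leibniz.IsMinimalIdeal ⊤ A ∧
      (∀ B : Submodule F L, Leibniz.IsMinimalIdeal ⊤ B → B = A) ∧
      2 ≤ Module.finrank F A ∧
      Leibniz.prod A A = ⊥ ∧
      (Leibniz.IsMinimalAbelianPlusLine H.toSubmodule ∨ Leibniz.IsHeisenberg H.toSubmodule) ∧
      (Leibniz.IsLie (⊤ : Submodule F L) ∨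
        (Leibniz.IsLie H.toSubmodule ∧ A = Leibniz.leib F L ∧ Leibniz.prod A ⊤ = ⊥)) := by
  have htop : (⊤ : Submodule F L) ≠ ⊥ := by
    intro h
    exact hmin.1 ⟨0, le_bot_iff.1 (h ▸ le_top)⟩
  obtain ⟨A, -, hA⟩ := Leibniz.exists_isMinimalIdeal_le
    (S := (⊤ : Submodule F L)) (I := ⊤) ⟨le_top, fun _ _ _ _ => ⟨trivial, trivial⟩⟩ htop
  have huniq : ∀ B : Submodule F L, Leibniz.IsMinimalIdeal ⊤ B → B = A := fun B hB =>
    Leibniz.isMinimalIdeal_unique hsolv hfree hmin hA hB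
  have hAA := hA.prod_self_eq_bot hsolv
  obtain ⟨H, hH⟩ := hA.exists_isCompl hAA hfree
  have hirr := Leibniz.isFaithfulIrreducible_of_isCompl hA hAA huniq hH
  have hK := Leibniz.properSquaresActNilpotently_of_isCompl hmin hA.1 hH
  have hN := Leibniz.prod_self_ne_bot_of_isCompl hmin hA.1 hAA hH
  have hHmul : ∀ x ∈ H.toSubmodule, ∀ y ∈ H.toSubmodule, x * y ∈ H.toSubmodule :=
    fun x hx y hy => H.mul_mem hx hy
  have hNH : Leibniz.prod H.toSubmodule H.toSubmodule ≠ H.toSubmodule := fun h =>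
    hN (h.trans ((hsolv.mono le_top).eq_bot_of_prod_self_eq h))
  have hstr := Leibniz.isLie_or_eq_leib hA hAA huniq hH
  have hLie : Leibniz.IsLie H.toSubmodule := hstr.elim (fun h x _ => h x trivial) fun h => h.1
  refine ⟨?_, A, H, hH, hA, huniq, hirr.two_le_finrank hHmul hN, hAA,
    hirr.isMinimalAbelianPlusLine_or_isHeisenberg hK hHmul hLie hN hNH, hstr⟩
  obtain ⟨p, hp⟩ := CharP.exists F
  rcases CharP.char_is_prime_or_zero F p with hprime | rfl
  · exact ⟨p, hprime, hp⟩
  · exact absurd (CharP.charP_to_charZero F) (hirr.not_charZero hK hHmul hLie hN hNH)
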